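/- Let $0<\alpha<\beta$, $p\in(0,1)$ and $\theta^\star\in\mathbb{R}$. On a probability space let $\omega^\star_1,\omega^\star_2,\dots$ and $\eta_1,\eta_2,\dots$ be mutually independent random variables such that each $\omega^\star_i$ takes the value $\beta$ with probability $p$ and the value $\alpha$ with probability $1-p$, and each $\eta_i$ is standard Gaussian $\mathsf N(0,1)$. Put $y_i=\theta^\star+\omega^\star_i\eta_i$. For $N\ge 1$, $\theta\in\mathbb{R}$ and $\omega\in\{\alpha,\beta\}^N$ let $$f(y,\omega|\theta)=\prod_{i=1}^N \rho(\omega_i)\,\frac{1}{\omega_i\sqrt{2\pi}}\,e^{-\frac{(y_i-\theta)^2}{2\omega_i^2}},\qquad \rho(\beta)=p,\quad \rho(\alpha)=1-p;$$ let further $L_N(\theta,\omega)=\frac1N\log f(y,\omega|\theta)$, let $\widehat\omega(\theta)$ be a maximizer of $L_N(\theta,\cdot)$ over $\{\alpha,\beta\}^N$ (the value $L_N(\theta,\widehat\omega(\theta))$ does not depend on its choice), and let $\mathcal S_N$ be the set of local maximum points of $\theta\mapsto L_N(\theta,\widehat\omega(\theta))$ on $\mathbb{R}$. Then for every $N\ge1$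 the maximum $\max_{\xi\in\mathcal S_N}|\xi-\theta^\star|$ exists, it is a square-integrable random variable, and $$\lim_{N\to+\infty}\max_{\xi\in\mathcal S_N}|\xi-\theta^\star|=0$$ both almost surely and in mean square, the latter meaning $\mathbb{E}\big[(\max_{\xi\in\mathcal S_N}|\xi-\theta^\star|)^2\big]\to 0$. -/

import Mathlib

open MeasureTheory ProbabilityTheory Filter Topology

noncomputable section

/-- A type configuration `ω ∈ {α, β}^N`. -/
abbrev Config (α β : ℝ) (N : ℕ) : Type := Fin N → ({α, β} : Set ℝ)

/-- The prior probability of a type `s ∈ {α, β}`: `p` for `β` and `1 - p` for `α`. -/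
def prior (p β s : ℝ) : ℝ := by
  classical exact if s = β then p else 1 - p

/-- The joint distribution `f(y, ω | θ)` of observations and types (density in `y`, probability
in `ω`): the types are independent with law `prior`, and given the types the `y i` are independent
Gaussian with mean `θ` and standard deviation `ω i`. -/
def jointDensity {α β : ℝ} (p : ℝ) {N : ℕ} (y : Fin N → ℝ) (ω : Config α β N) (θ : ℝ) : ℝ :=
  ∏ i, prior p β (ω i) * gaussianPDFReal θ ⟨(ω i : ℝ) ^ 2, sq_nonneg _⟩ (y i)

/-- The rescaled log-likelihood `L_N(θ, ω) = (1/N) log f(y, ω | θ)`. -/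
def logLik {α β : ℝ} (p : ℝ) {N : ℕ} (y : Fin N → ℝ) (θ : ℝ) (ω : Config α β N) : ℝ :=
  (1 / (N : ℝ)) * Real.log (jointDensity p y ω θ)

instance (α β : ℝ) (N : ℕ) : Nonempty (Config α β N) := ⟨fun _ => ⟨α, by simp⟩⟩

theorem exists_argmax_logLik (α β p : ℝ) {N : ℕ} (y : Fin N → ℝ) (θ : ℝ) :
    ∃ ω₀ : Config α β N, ∀ ω : Config α β N, logLik p y θ ω ≤ logLik p y θ ω₀ :=
  Finite.exists_max _

/-- `ω̂(θ)`, a maximizer of `ω ↦ L_N(θ, ω)` over the finite set `{α, β}^N`. If there are several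
maximizers, the value `L_N(θ, ω̂(θ))` does not depend on which of them is taken. -/
def omegaHat (α β p : ℝ) {N : ℕ} (y : Fin N → ℝ) (θ : ℝ) : Config α β N :=
  (exists_argmax_logLik α β p y θ).choose

/-- The set `S_N` of local maxima of `θ ↦ L_N(θ, ω̂(θ))`. -/
def localMaxima (α β p : ℝ) {N : ℕ} (y : Fin N → ℝ) : Set ℝ :=
  {ξ | IsLocalMax (fun θ : ℝ => logLik p y θ (omegaHat α β p y θ)) ξ}

/-- The set of distances `|ξ - θ⋆|` for `ξ ∈ S_N`. -/
def deviations (α β p θs : ℝ) {N : ℕ} (y : Fin N → ℝ) : Set ℝ :=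
  (fun ξ => |ξ - θs|) '' localMaxima α β p y

/-- The number `max_{ξ ∈ S_N} |ξ - θ⋆|`, written as a supremum; that it is attained
is to be shown separately. -/
def maxDeviation (α β p θs : ℝ) {N : ℕ} (y : Fin N → ℝ) : ℝ :=
  sSup (deviations α β p θs y)

/-- The first `N` observations `y_i = θ⋆ + ω⋆_i η_i`, at the sample point `x`. -/
def observations {Ω : Type*} (θs : ℝ) (ωs η : ℕ → Ω → ℝ) (N : ℕ) (x : Ω) : Fin N → ℝ :=
  fun i => θs + ωs i x * η i x

end

/-! Maximizing over the types turns the log-likelihood into a maximum of finitely many concave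
parabolas in `θ`, one for each `ω`, of curvature at most `a = 1/(2α²)`. At a local maximum `ξ` every
parabola that touches the profile has its vertex at `ξ`, so the profile satisfies the global bound
`profile (ξ + h) ≥ profile ξ - a h²` (`profile_sub_le`). In particular `ξ` is one of finitely many
weighted means, so the maximal deviation is attained.

The profile is also, up to a constant, the average of `bump (y i - θ) - b (y i - θ)²` with `b =
1/(2β²)` and `bump` bounded, even and decreasing in `|u|`. With `t = ξ - θs` and `z i = y i - θs`,
the two facts combine into `Stationary`: the increment of the averaged bump from `t` to `t + h` is
at least `2bht` minus `2bh` times the mean of `z`, up to terms of order `h²`.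

By the strong law the mean of `z` tends to `0` and the averaged bump tends to `K t = E[bump (z 0 -
t)]`. As `z 0` is a scale mixture of centered Gaussians, `K` is nonincreasing on `[0, ∞)`
(`integral_gaussian_unimodal`). For `t > 0` and small `h > 0` the increment is then asymptotically
nonpositive while the lower bound is positive, a contradiction. Compactness and the reflection `z ↦
-z` exclude every `t` with `|t| ≥ ε`.

Taking `h = ±1` gives `|t| ≤ C + |mean of z|` for every sample. Since the mean of `z` tends to `0`
in `L²`, this upgrades almost sure to mean square convergence. -/

/-- The logarithm of the joint density of a type `s` and a residual `u`. -/
noncomputable def score (p β s u : ℝ) : ℝ :=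
  Real.log (prior p β s * (√(2 * Real.pi * s ^ 2))⁻¹) - u ^ 2 / (2 * s ^ 2)

theorem Config.pos {α β : ℝ} (hα : 0 < α) (hαβ : α < β) {N : ℕ} (ω : Config α β N) (i : Fin N) :
    0 < (ω i : ℝ) := by
  rcases (ω i).2 with h | h
  · rw [h]; exact hα
  · rw [Set.mem_singleton_iff.1 h]; exact hα.trans hαβ

theorem prior_pos {p : ℝ} (hp₀ : 0 < p) (hp₁ : p < 1) (β s : ℝ) : 0 < prior p β s := by
  unfold prior
  split_ifs
  · exact hp₀
  · linarith

theorem logLik_eq_sum_score {α β p : ℝ} (hα : 0 < α) (hαβ : α < β) (hp₀ : 0 < p) (hp₁ : p < 1)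
    {N : ℕ} (y : Fin N → ℝ) (θ : ℝ) (ω : Config α β N) :
    logLik p y θ ω = (1 / (N : ℝ)) * ∑ i, score p β (ω i) (y i - θ) := by
  unfold logLik jointDensity
  congr 1
  have key : ∀ i, 0 < prior p β (ω i) * (√(2 * Real.pi * (ω i : ℝ) ^ 2))⁻¹ := fun i => by
    have := prior_pos hp₀ hp₁ β (ω i)
    have := ω.pos hα hαβ i
    positivity
  have hfac : ∀ i, prior p β (ω i) * gaussianPDFReal θ ⟨(ω i : ℝ) ^ 2, sq_nonneg _⟩ (y i)
      = (prior p β (ω i) * (√(2 * Real.pi * (ω i : ℝ) ^ 2))⁻¹) *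
        Real.exp (-(y i - θ) ^ 2 / (2 * (ω i : ℝ) ^ 2)) := fun i => by
    have (v : NNReal) (hv : (v : ℝ) = (ω i : ℝ) ^ 2) : prior p β (ω i) * gaussianPDFReal θ v (y i)
        = (prior p β (ω i) * (√(2 * Real.pi * (ω i : ℝ) ^ 2))⁻¹) *
          Real.exp (-(y i - θ) ^ 2 / (2 * (ω i : ℝ) ^ 2)) := by
      simp only [gaussianPDFReal_def, hv]
      ring
    exact this _ rfl
  rw [Real.log_prod]
  · refine Finset.sum_congr rfl fun i _ => ?_
    rw [hfac, Real.log_mul (key i).ne' (Real.exp_pos _).ne', Real.log_exp, score]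
    ring
  · intro i _
    rw [hfac]
    exact (mul_pos (key i) (Real.exp_pos _)).ne'

/-- The log-likelihood maximized over the types. -/
noncomputable def profile (α β p : ℝ) {N : ℕ} (y : Fin N → ℝ) (θ : ℝ) : ℝ :=
  logLik p y θ (omegaHat α β p y θ)

theorem logLik_le_profile {α β p : ℝ} {N : ℕ} (y : Fin N → ℝ) (θ : ℝ) (ω : Config α β N) :
    logLik p y θ ω ≤ profile α β p y θ :=
  (exists_argmax_logLik α β p y θ).choose_spec ω

/-- The maximum likelihood estimate of `θ` for known types: a weighted mean. -/
noncomputable def weightedMean {α β : ℝ} {N : ℕ} (y : Fin N → ℝ) (ω : Config α β N) : ℝ :=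
  (∑ i, y i / (ω i : ℝ) ^ 2) / ∑ i, 1 / (ω i : ℝ) ^ 2

/-- The curvature of `θ ↦ L_N(θ, ω)`. -/
noncomputable def curvature {α β : ℝ} {N : ℕ} (ω : Config α β N) : ℝ :=
  (1 / (N : ℝ)) * ∑ i, 1 / (2 * (ω i : ℝ) ^ 2)

/-! ### Local maxima of the profile for a fixed sample -/

section deterministic

variable {α β p : ℝ} {N : ℕ}

theorem sum_inv_sq_pos (hα : 0 < α) (hαβ : α < β) (hN : 1 ≤ N) (ω : Config α β N) :
    0 < ∑ i, 1 / (ω i : ℝ) ^ 2 := by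
  have : Nonempty (Fin N) := ⟨⟨0, hN⟩⟩
  refine Finset.sum_pos (fun i _ => ?_) Finset.univ_nonempty
  have := ω.pos hα hαβ i
  positivity

theorem curvature_pos (hα : 0 < α) (hαβ : α < β) (hN : 1 ≤ N) (ω : Config α β N) :
    0 < curvature ω := by
  have : Nonempty (Fin N) := ⟨⟨0, hN⟩⟩
  have hN' : (0 : ℝ) < N := by exact_mod_cast hN
  refine mul_pos (by positivity) (Finset.sum_pos (fun i _ => ?_) Finset.univ_nonempty)
  have := ω.pos hα hαβ i
  positivity

theorem curvature_le (hα : 0 < α) (hαβ : α < β) (hN : 1 ≤ N) (ω : Config α β N) :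
    curvature ω ≤ 1 / (2 * α ^ 2) := by
  have hN' : (0 : ℝ) < N := by exact_mod_cast hN
  have : ∑ i, 1 / (2 * (ω i : ℝ) ^ 2) ≤ ∑ _i : Fin N, 1 / (2 * α ^ 2) := by
    refine Finset.sum_le_sum fun i _ => ?_
    have : α ≤ ω i := by
      rcases (ω i).2 with h | h
      · exact h.ge
      · rw [Set.mem_singleton_iff.1 h]; exact hαβ.le
    gcongr
  calc curvature ω ≤ (1 / (N : ℝ)) * ∑ _i : Fin N, 1 / (2 * α ^ 2) := by
        unfold curvature; gcongr
    _ = _ := by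
        rw [Finset.sum_const, Finset.card_univ, Fintype.card_fin, nsmul_eq_mul]
        field_simp

theorem logLik_eq_vertex (hα : 0 < α) (hαβ : α < β) (hp₀ : 0 < p) (hp₁ : p < 1) (hN : 1 ≤ N)
    (y : Fin N → ℝ) (ω : Config α β N) (θ : ℝ) :
    logLik p y θ ω = logLik p y (weightedMean y ω) ω
      - curvature ω * (θ - weightedMean y ω) ^ 2 := by
  have hW := sum_inv_sq_pos hα hαβ hN ω
  set m := weightedMean y ω with hm
  -- The weighted residuals sum to zero, which kills the linear term when the square is completed
  -- around `m`.
  have hzero : ∑ i, (y i - m) / (ω i : ℝ) ^ 2 = 0 := by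
    have : m * ∑ i, 1 / (ω i : ℝ) ^ 2 = ∑ i, y i / (ω i : ℝ) ^ 2 := by
      rw [hm, weightedMean]; field_simp
    simp only [sub_div, Finset.sum_sub_distrib]
    rw [← this, Finset.mul_sum]
    simp [div_eq_mul_inv]
  rw [logLik_eq_sum_score hα hαβ hp₀ hp₁, logLik_eq_sum_score hα hαβ hp₀ hp₁, curvature,
    mul_assoc, ← mul_sub]
  congr 1
  have hlin : ∑ i, score p β (ω i) (y i - θ) = ∑ i, score p β (ω i) (y i - m)
      + (θ - m) * ∑ i, (y i - m) / (ω i : ℝ) ^ 2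
      - (∑ i, 1 / (2 * (ω i : ℝ) ^ 2)) * (θ - m) ^ 2 := by
    rw [Finset.mul_sum, Finset.sum_mul, ← Finset.sum_add_distrib, ← Finset.sum_sub_distrib]
    refine Finset.sum_congr rfl fun i _ => ?_
    have := (ω.pos hα hαβ i).ne'
    unfold score
    field_simp
    ring
  rw [hlin, hzero]; ring

theorem logLik_le_weightedMean (hα : 0 < α) (hαβ : α < β) (hp₀ : 0 < p) (hp₁ : p < 1) (hN : 1 ≤ N)
    (y : Fin N → ℝ) (ω : Config α β N) (θ : ℝ) :
    logLik p y θ ω ≤ logLik p y (weightedMean y ω) ω := by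
  rw [logLik_eq_vertex hα hαβ hp₀ hp₁ hN y ω θ]
  have := (curvature_pos hα hαβ hN ω).le
  nlinarith [mul_nonneg this (sq_nonneg (θ - weightedMean y ω))]

theorem eq_weightedMean_of_isLocalMax (hα : 0 < α) (hαβ : α < β) (hp₀ : 0 < p) (hp₁ : p < 1)
    (hN : 1 ≤ N) {y : Fin N → ℝ} {ω : Config α β N} {ξ : ℝ}
    (h : IsLocalMax (fun θ => logLik p y θ ω) ξ) : ξ = weightedMean y ω := by
  have hc := curvature_pos hα hαβ hN ω
  have hd : HasDerivAt (fun θ => logLik p y θ ω)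
      (-(curvature ω * (2 * (ξ - weightedMean y ω)))) ξ := by
    have h1 : HasDerivAt (fun θ => logLik p y (weightedMean y ω) ω
        - curvature ω * (θ - weightedMean y ω) ^ 2)
        (-(curvature ω * (2 * (ξ - weightedMean y ω)))) ξ := by
      have := ((((hasDerivAt_id ξ).sub_const (weightedMean y ω)).pow 2).const_mul
        (curvature ω)).const_sub (logLik p y (weightedMean y ω) ω)
      simpa using this
    exact h1.congr_of_eventuallyEq
      (Eventually.of_forall fun θ => logLik_eq_vertex hα hαβ hp₀ hp₁ hN y ω θ)
  have h0 := h.hasDerivAt_eq_zero hd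
  rcases mul_eq_zero.1 (neg_eq_zero.1 h0) with h1 | h1
  · exact absurd h1 hc.ne'
  · linarith

theorem continuous_logLik (hα : 0 < α) (hαβ : α < β) (hp₀ : 0 < p) (hp₁ : p < 1) (y : Fin N → ℝ)
    (ω : Config α β N) : Continuous fun θ : ℝ => logLik p y θ ω := by
  simp only [logLik_eq_sum_score hα hαβ hp₀ hp₁, score]
  fun_prop

theorem measurable_logLik (hα : 0 < α) (hαβ : α < β) (hp₀ : 0 < p) (hp₁ : p < 1)
    {m : (Fin N → ℝ) → ℝ} (hm : Measurable m) (ω : Config α β N) :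
    Measurable fun y : Fin N → ℝ => logLik p y (m y) ω := by
  simp only [logLik_eq_sum_score hα hαβ hp₀ hp₁, score]
  fun_prop

/-- A minorant that touches a function at a local maximum has a local maximum there too. -/
theorem isLocalMax_logLik (y : Fin N → ℝ) {ξ : ℝ} (hξ : ξ ∈ localMaxima α β p y)
    {ω : Config α β N} (hω : logLik p y ξ ω = profile α β p y ξ) :
    IsLocalMax (fun θ => logLik p y θ ω) ξ := by
  have h : ∀ᶠ θ in 𝓝 ξ, profile α β p y θ ≤ profile α β p y ξ := hξ
  filter_upwards [h] with θ hθ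
  exact (logLik_le_profile y θ ω).trans (hθ.trans hω.ge)

/-- Configurations below the profile at `ξ` stay below nearby by continuity, so only the touching
parabolas matter. The criterion is a finite combination of comparisons between measurable functions
of `y`, which is what measurability of the maximum needs. -/
theorem mem_localMaxima_iff (hα : 0 < α) (hαβ : α < β) (hp₀ : 0 < p) (hp₁ : p < 1)
    (hN : 1 ≤ N) (y : Fin N → ℝ) (ξ : ℝ) :
    ξ ∈ localMaxima α β p y ↔ ∀ ω : Config α β N,
      (∃ ω' : Config α β N, logLik p y ξ ω < logLik p y ξ ω') ∨ ξ = weightedMean y ω := by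
  constructor
  · intro hξ ω
    rcases (logLik_le_profile (p := p) y ξ ω).lt_or_eq with h | h
    · exact Or.inl ⟨_, h⟩
    · exact Or.inr (eq_weightedMean_of_isLocalMax hα hαβ hp₀ hp₁ hN (isLocalMax_logLik y hξ h))
  · intro H
    have : ∀ ω : Config α β N, ∀ᶠ θ in 𝓝 ξ, logLik p y θ ω ≤ profile α β p y ξ := by
      intro ω
      rcases H ω with ⟨ω', h⟩ | h
      · have hc := continuous_logLik hα hαβ hp₀ hp₁ y ω
        have h' := h.trans_le (logLik_le_profile y ξ ω')
        exact (hc.continuousAt.eventually_lt continuousAt_const h').mono fun _ => le_of_lt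
      · refine Eventually.of_forall fun θ => ?_
        refine le_trans ?_ (logLik_le_profile y ξ ω)
        rw [h]
        exact logLik_le_weightedMean hα hαβ hp₀ hp₁ hN y ω θ
    have h2 := eventually_all.2 this
    exact h2.mono fun θ hθ => hθ (omegaHat α β p y θ)

theorem exists_eq_weightedMean (hα : 0 < α) (hαβ : α < β) (hp₀ : 0 < p) (hp₁ : p < 1)
    (hN : 1 ≤ N) {y : Fin N → ℝ} {ξ : ℝ} (hξ : ξ ∈ localMaxima α β p y) :
    ∃ ω : Config α β N, ξ = weightedMean y ω :=
  ⟨_, eq_weightedMean_of_isLocalMax hα hαβ hp₀ hp₁ hN (isLocalMax_logLik y hξ rfl)⟩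

theorem localMaxima_nonempty (hα : 0 < α) (hαβ : α < β) (hp₀ : 0 < p) (hp₁ : p < 1)
    (hN : 1 ≤ N) (y : Fin N → ℝ) : (localMaxima α β p y).Nonempty := by
  obtain ⟨ω₀, h₀⟩ := Finite.exists_max fun ω : Config α β N => logLik p y (weightedMean y ω) ω
  refine ⟨weightedMean y ω₀, Eventually.of_forall fun θ => ?_⟩
  exact (logLik_le_weightedMean hα hαβ hp₀ hp₁ hN y _ θ).trans
    ((h₀ _).trans (logLik_le_profile y _ ω₀))

theorem isGreatest_maxDeviation (hα : 0 < α) (hαβ : α < β) (hp₀ : 0 < p) (hp₁ : p < 1)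
    (hN : 1 ≤ N) (θs : ℝ) (y : Fin N → ℝ) :
    IsGreatest (deviations α β p θs y) (maxDeviation α β p θs y) := by
  have hfin : (deviations α β p θs y).Finite := by
    refine Set.Finite.image _ ((Set.finite_range fun ω : Config α β N => weightedMean y ω).subset ?_)
    intro ξ hξ
    obtain ⟨ω, h⟩ := exists_eq_weightedMean hα hαβ hp₀ hp₁ hN hξ
    exact ⟨ω, h.symm⟩
  have hne : (deviations α β p θs y).Nonempty :=
    (localMaxima_nonempty hα hαβ hp₀ hp₁ hN y).image _
  exact ⟨hne.csSup_mem hfin, fun a ha => le_csSup hfin.bddAbove ha⟩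

open Classical in
-- All local maxima are weighted means, so a supremum over a fixed finite index set suffices; the
-- filler value `0` is harmless because deviations are nonnegative.
theorem maxDeviation_eq_iSup (hα : 0 < α) (hαβ : α < β) (hp₀ : 0 < p) (hp₁ : p < 1)
    (hN : 1 ≤ N) (θs : ℝ) (y : Fin N → ℝ) :
    maxDeviation α β p θs y = ⨆ ω : Config α β N,
      if weightedMean y ω ∈ localMaxima α β p y then |weightedMean y ω - θs| else 0 := by
  have hG := isGreatest_maxDeviation hα hαβ hp₀ hp₁ hN θs y
  apply le_antisymm
  · obtain ⟨ξ, hξ, h⟩ := hG.1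
    obtain ⟨ω, rfl⟩ := exists_eq_weightedMean hα hαβ hp₀ hp₁ hN hξ
    refine le_ciSup_of_le (Set.finite_range _).bddAbove ω ?_
    rw [if_pos hξ]
    exact h.ge
  · refine ciSup_le fun ω => ?_
    split_ifs with h
    · exact hG.2 ⟨_, h, rfl⟩
    · obtain ⟨ξ, hξ, h⟩ := hG.1
      rw [← h]; exact abs_nonneg _

theorem measurable_maxDeviation (hα : 0 < α) (hαβ : α < β) (hp₀ : 0 < p) (hp₁ : p < 1)
    (hN : 1 ≤ N) (θs : ℝ) : Measurable fun y : Fin N → ℝ => maxDeviation α β p θs y := by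
  classical
  simp only [maxDeviation_eq_iSup hα hαβ hp₀ hp₁ hN]
  have hm : ∀ ω : Config α β N, Measurable fun y : Fin N → ℝ => weightedMean y ω := fun ω => by
    unfold weightedMean; fun_prop
  refine Measurable.iSup fun ω => Measurable.ite ?_ ((hm ω).sub_const θs).abs measurable_const
  simp only [mem_localMaxima_iff hα hαβ hp₀ hp₁ hN, Set.ofPred_forall, Set.ofPred_or,
    Set.ofPred_exists]
  have hL : ∀ ω' : Config α β N, Measurable fun y : Fin N → ℝ =>
      logLik p y (weightedMean y ω) ω' := fun ω' =>
    measurable_logLik hα hαβ hp₀ hp₁ (hm ω) ω'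
  exact MeasurableSet.iInter fun ω' => (MeasurableSet.iUnion fun ω'' =>
    measurableSet_lt (hL ω') (hL ω'')).union (measurableSet_eq_fun (hm ω) (hm ω'))

/-- The parabola active at `ξ` has its vertex there and lies below the profile everywhere, so the
bound holds for all `h`, not only for small ones. -/
theorem profile_sub_le (hα : 0 < α) (hαβ : α < β) (hp₀ : 0 < p) (hp₁ : p < 1)
    (hN : 1 ≤ N) {y : Fin N → ℝ} {ξ : ℝ} (hξ : ξ ∈ localMaxima α β p y) (h : ℝ) :
    profile α β p y ξ - 1 / (2 * α ^ 2) * h ^ 2 ≤ profile α β p y (ξ + h) := by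
  set ω := omegaHat α β p y ξ
  have hm := eq_weightedMean_of_isLocalMax hα hαβ hp₀ hp₁ hN (isLocalMax_logLik y hξ (ω := ω) rfl)
  have h1 := logLik_le_profile (p := p) y (ξ + h) ω
  have h2 := logLik_eq_vertex hα hαβ hp₀ hp₁ hN y ω (ξ + h)
  rw [← hm] at h2
  have h3 := mul_le_mul_of_nonneg_right (curvature_le hα hαβ hN ω) (sq_nonneg h)
  have h4 : profile α β p y ξ = logLik p y ξ ω := rfl
  rw [add_sub_cancel_left] at h2
  linarith

/-- The bounded part of the profile of a single observation, as a function of the residual. -/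
noncomputable def bump (α β p u : ℝ) : ℝ :=
  max (score p β α 0 - score p β β 0 - (1 / (2 * α ^ 2) - 1 / (2 * β ^ 2)) * u ^ 2) 0

/-- Factoring out the flatter parabola, that of `β`, leaves a positive part. -/
theorem max_score (u : ℝ) :
    max (score p β α u) (score p β β u)
      = score p β β 0 + (bump α β p u - 1 / (2 * β ^ 2) * u ^ 2) := by
  have h1 : ∀ s, score p β s u = score p β s 0 - 1 / (2 * s ^ 2) * u ^ 2 := fun s => by
    unfold score; ring
  rw [h1 α, h1 β, bump, ← max_sub_sub_right, ← max_add_add_left]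
  congr 1 <;> ring

theorem profile_eq (hα : 0 < α) (hαβ : α < β) (hp₀ : 0 < p) (hp₁ : p < 1)
    (hN : 1 ≤ N) (y : Fin N → ℝ) (θ : ℝ) :
    profile α β p y θ = score p β β 0 +
      (1 / (N : ℝ)) * ∑ i, (bump α β p (y i - θ) - 1 / (2 * β ^ 2) * (y i - θ) ^ 2) := by
  have hN' : (0 : ℝ) < N := by exact_mod_cast hN
  have hsum : profile α β p y θ
      = (1 / (N : ℝ)) * ∑ i, max (score p β α (y i - θ)) (score p β β (y i - θ)) := by
    apply le_antisymm
    · rw [profile, logLik_eq_sum_score hα hαβ hp₀ hp₁]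
      gcongr with i
      rcases (omegaHat α β p y θ i).2 with h | h
      · rw [h]; exact le_max_left _ _
      · rw [Set.mem_singleton_iff.1 h]; exact le_max_right _ _
    · have : ∀ i : Fin N, ∃ s : ({α, β} : Set ℝ),
          max (score p β α (y i - θ)) (score p β β (y i - θ)) = score p β s (y i - θ) := by
        intro i
        rcases max_choice (score p β α (y i - θ)) (score p β β (y i - θ)) with h | h
        · exact ⟨⟨α, by simp⟩, h⟩
        · exact ⟨⟨β, by simp⟩, h⟩
      choose ω hω using this
      simp only [hω]
      rw [← logLik_eq_sum_score hα hαβ hp₀ hp₁]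
      exact logLik_le_profile y θ ω
  rw [hsum]
  simp only [max_score]
  rw [Finset.sum_add_distrib, Finset.sum_const, Finset.card_univ, Fintype.card_fin, nsmul_eq_mul, mul_add, ← mul_assoc,
    one_div_mul_cancel hN'.ne', one_mul]

/-- This is `profile_sub_le` with the quadratic part of the profile expanded explicitly and moved to
the left. -/
theorem stationarity (hα : 0 < α) (hαβ : α < β) (hp₀ : 0 < p) (hp₁ : p < 1)
    (hN : 1 ≤ N) {θs : ℝ} {z : Fin N → ℝ} {ξ : ℝ}
    (hξ : ξ ∈ localMaxima α β p fun i => θs + z i) (h : ℝ) :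
    1 / (2 * β ^ 2) * (2 * h * (ξ - θs) + h ^ 2 - 2 * h * ((∑ i, z i) / N))
        - 1 / (2 * α ^ 2) * h ^ 2
      ≤ (∑ i, bump α β p (z i - (ξ - θs + h))) / N - (∑ i, bump α β p (z i - (ξ - θs))) / N := by
  have hN' : (0 : ℝ) < N := by exact_mod_cast hN
  have key := profile_sub_le hα hαβ hp₀ hp₁ hN hξ h
  rw [profile_eq hα hαβ hp₀ hp₁ hN, profile_eq hα hαβ hp₀ hp₁ hN] at key
  have e1 : ∀ i, θs + z i - ξ = z i - (ξ - θs) := fun i => by ring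
  have e2 : ∀ i, θs + z i - (ξ + h) = z i - (ξ - θs + h) := fun i => by ring
  simp only [e1, e2, Finset.sum_sub_distrib] at key
  have e3 : ∑ i, 1 / (2 * β ^ 2) * (z i - (ξ - θs + h)) ^ 2
      = ∑ i, 1 / (2 * β ^ 2) * (z i - (ξ - θs)) ^ 2
        + 1 / (2 * β ^ 2) * (N * (2 * h * (ξ - θs) + h ^ 2) - 2 * h * ∑ i, z i) := by
    have : (N : ℝ) * (2 * h * (ξ - θs) + h ^ 2) = ∑ _i : Fin N, (2 * h * (ξ - θs) + h ^ 2) := by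
      rw [Finset.sum_const, Finset.card_univ, Fintype.card_fin, nsmul_eq_mul]
    rw [this, Finset.mul_sum, ← Finset.sum_sub_distrib, Finset.mul_sum, ← Finset.sum_add_distrib]
    exact Finset.sum_congr rfl fun i _ => by ring
  rw [e3] at key
  have e4 : 1 / (N : ℝ) * (1 / (2 * β ^ 2) * (N * (2 * h * (ξ - θs) + h ^ 2) - 2 * h * ∑ i, z i))
      = 1 / (2 * β ^ 2) * (2 * h * (ξ - θs) + h ^ 2 - 2 * h * ((∑ i, z i) / N)) := by
    field_simp
  rw [← e4, ← one_div_mul_eq_div (N : ℝ) (∑ i, bump α β p (z i - (ξ - θs + h))),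
    ← one_div_mul_eq_div (N : ℝ) (∑ i, bump α β p (z i - (ξ - θs)))]
  rw [mul_sub, mul_sub, mul_add] at key
  linarith

end deterministic

/-! ### Shape and regularity of the bump -/

section bump

theorem continuous_bump (α β p : ℝ) : Continuous (bump α β p) := by
  unfold bump; fun_prop

theorem bump_nonneg (α β p u : ℝ) : 0 ≤ bump α β p u := le_max_right _ _

variable {α β : ℝ}

theorem curvature_gap_pos (hα : 0 < α) (hαβ : α < β) :
    0 < 1 / (2 * α ^ 2) - 1 / (2 * β ^ 2) := by
  rw [sub_pos]
  gcongr

theorem bump_anti (hα : 0 < α) (hαβ : α < β) (p : ℝ) {u v : ℝ} (h : |u| ≤ |v|) :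
    bump α β p v ≤ bump α β p u := by
  unfold bump
  have := mul_le_mul_of_nonneg_left (sq_le_sq.2 h) (curvature_gap_pos hα hαβ).le
  exact max_le_max (by linarith) le_rfl

theorem bump_neg (p u : ℝ) : bump α β p (-u) = bump α β p u := by
  simp [bump]

theorem bump_le (hα : 0 < α) (hαβ : α < β) (p u : ℝ) : bump α β p u ≤ bump α β p 0 :=
  bump_anti hα hαβ p (by simp)

theorem uniformContinuous_bump (hα : 0 < α) (hαβ : α < β) (p : ℝ) :
    UniformContinuous (bump α β p) := by
  have hc := curvature_gap_pos hα hαβ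
  refine (continuous_bump α β p).uniformContinuous_of_tendsto_cocompact (x := 0) ?_
  set D := score p β α 0 - score p β β 0
  set c := 1 / (2 * α ^ 2) - 1 / (2 * β ^ 2)
  refine tendsto_const_nhds.congr' ?_
  -- The bump vanishes once `c u² ≥ D`; the bound `|u| ≥ 1` gives `|u| ≤ u²`, so `|u| ≥ D / c` is
  -- then enough.
  have := (tendsto_norm_cocompact_atTop (E := ℝ)).eventually_ge_atTop (max 1 (D / c))
  filter_upwards [this] with u hu
  rw [Real.norm_eq_abs] at hu
  have h1 : 1 ≤ |u| := (le_max_left _ _).trans hu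
  have h2 : D / c ≤ |u| := (le_max_right _ _).trans hu
  have h3 : D ≤ c * |u| := by rwa [div_le_iff₀' hc] at h2
  have h4 : c * |u| ≤ c * u ^ 2 := by
    rw [← sq_abs]; gcongr; nlinarith
  exact (max_eq_right (by simp only [sub_nonpos]; linarith)).symm

end bump

/-! ### Unimodality under Gaussian averaging -/

section unimodal

variable {k : ℝ → ℝ}

/-- Convolving an even function that decreases away from the origin with a centered Gaussian law
preserves unimodality. -/
theorem integral_gaussian_unimodal (hk : Continuous k) {C : ℝ} (hC : ∀ u, |k u| ≤ C)
    (hanti : ∀ u v, |u| ≤ |v| → k v ≤ k u) {v : NNReal} (hv : v ≠ 0) {s t : ℝ} (hs : 0 ≤ s)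
    (hst : s ≤ t) :
    ∫ x, k (x - t) ∂gaussianReal 0 v ≤ ∫ x, k (x - s) ∂gaussianReal 0 v := by
  set φ := gaussianPDFReal 0 v with hφ
  set m := (s + t) / 2 with hm
  set h := (t - s) / 2 with hh
  have hint : ∀ c d : ℝ, Integrable (fun x => φ (x + d) * k (x + c)) := fun c d => by
    refine Integrable.mul_bdd (c := C) ((integrable_gaussianPDFReal 0 v).comp_add_right d)
      (by fun_prop) (Eventually.of_forall fun x => hC _)
  have hint' : ∀ c d : ℝ, Integrable (fun x => φ (d - x) * k (x + c)) := fun c d => by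
    refine Integrable.mul_bdd (c := C) ((integrable_gaussianPDFReal 0 v).comp_sub_left d)
      (by fun_prop) (Eventually.of_forall fun x => hC _)
  have heven : ∀ u, k (-u) = k u := fun u =>
    le_antisymm (hanti _ _ (by simp)) (hanti _ _ (by simp))
  have hφanti : ∀ u w, |u| ≤ |w| → φ w ≤ φ u := fun u w huw => by
    have := sq_le_sq.2 huw
    simp only [hφ, gaussianPDFReal, sub_zero]
    gcongr
  have hφeven : ∀ u, φ (-u) = φ u := fun u =>
    le_antisymm (hφanti _ _ (by simp)) (hφanti _ _ (by simp))
  -- Center at the midpoint `m` of `s` and `t`. Averaging this formula with its reflection `e'`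
  -- reduces the claim to the pointwise inequality `hpt`.
  have e : ∀ r, ∫ x, k (x - r) ∂gaussianReal 0 v = ∫ x, φ (x + m) * k (x + (m - r)) := fun r => by
    rw [integral_gaussianReal_eq_integral_smul hv,
      ← integral_add_right_eq_self _ m]
    simp [hφ, add_sub_assoc]
  have e' : ∀ r, ∫ x, k (x - r) ∂gaussianReal 0 v = ∫ x, φ (m - x) * k (x + -(m - r)) := fun r => by
    rw [e, ← integral_neg_eq_self]
    refine integral_congr_ae (Eventually.of_forall fun x => ?_)
    simp only
    rw [← heven (x + -(m - r))]
    congr 2 <;> ring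
  have hms : m - s = h := by rw [hm, hh]; ring
  have hmt : m - t = -h := by rw [hm, hh]; ring
  have hm0 : 0 ≤ m := by rw [hm]; linarith
  have hh0 : 0 ≤ h := by rw [hh]; linarith
  have hpt : ∀ x, φ (x + m) * k (x + -h) + φ (m - x) * k (x + h)
      ≤ φ (x + m) * k (x + h) + φ (m - x) * k (x + -h) := fun x => by
    -- Both factors are nonpositive for `x ≥ 0` and nonnegative for `x ≤ 0`, since `m` and `h` are
    -- nonnegative and `φ` and `k` decrease in the absolute value.
    have : 0 ≤ (φ (x + m) - φ (m - x)) * (k (x + h) - k (x + -h)) := by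
      rcases le_total 0 x with hx | hx
      · refine mul_nonneg_of_nonpos_of_nonpos (sub_nonpos.2 (hφanti _ _ ?_))
          (sub_nonpos.2 (hanti _ _ ?_)) <;>
        · apply abs_le_abs <;> linarith
      · refine mul_nonneg (sub_nonneg.2 (hφanti _ _ ?_)) (sub_nonneg.2 (hanti _ _ ?_))
        · rw [abs_of_nonneg (by linarith : 0 ≤ m - x)]
          exact abs_le.2 ⟨by linarith, by linarith⟩
        · rw [abs_of_nonpos (by linarith : x + -h ≤ 0)]
          exact abs_le.2 ⟨by linarith, by linarith⟩
    linarith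
  have hmono := integral_mono ((hint (-h) m).add (hint' h m)) ((hint h m).add (hint' (-h) m)) hpt
  simp only [Pi.add_apply] at hmono
  rw [integral_add (hint _ _) (hint' _ _), integral_add (hint _ _) (hint' _ _)] at hmono
  have es := e s
  have et := e t
  have es' := e' s
  have et' := e' t
  rw [hms] at es es'
  rw [hmt] at et et'
  simp only [neg_neg] at et'
  linarith

theorem integral_scaled_gaussian_unimodal (hk : Continuous k) {C : ℝ} (hC : ∀ u, |k u| ≤ C)
    (hanti : ∀ u v, |u| ≤ |v| → k v ≤ k u) (w : ℝ) {s t : ℝ} (hs : 0 ≤ s) (hst : s ≤ t) :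
    ∫ x, k (w * x - t) ∂gaussianReal 0 1 ≤ ∫ x, k (w * x - s) ∂gaussianReal 0 1 := by
  by_cases hw : w = 0
  · subst hw
    simp only [zero_mul, zero_sub, integral_const, probReal_univ, one_smul]
    exact hanti _ _ (by rw [abs_neg, abs_neg]; exact abs_le_abs hst (by linarith))
  · have e : ∀ r, ∫ x, k (w * x - r) ∂gaussianReal 0 1
        = ∫ x, k (x - r) ∂gaussianReal 0 (.mk (w ^ 2) (sq_nonneg _) * 1) := fun r => by
      have := gaussianReal_map_const_mul (μ := 0) (v := 1) w
      rw [mul_zero] at this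
      rw [← this, integral_map (by fun_prop) (by fun_prop)]
    rw [e, e]
    refine integral_gaussian_unimodal hk hC hanti ?_ hs hst
    rw [mul_one]
    intro h
    exact pow_ne_zero 2 hw (congrArg NNReal.toReal h)

end unimodal

/-! ### Asymptotic exclusion of stationary points away from zero -/

/-- The average of `k (z i - t)` over the first `N` terms of the sequence `z`. -/
noncomputable def shiftAvg (k : ℝ → ℝ) (z : ℕ → ℝ) (N : ℕ) (t : ℝ) : ℝ :=
  (∑ i ∈ Finset.range N, k (z i - t)) / N

/-- Global second-order optimality inequality satisfied at a local maximum of the profile, with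
`a` and `b` the largest and the smallest curvature. -/
def Stationary (a b : ℝ) (k : ℝ → ℝ) (z : ℕ → ℝ) (N : ℕ) (t : ℝ) : Prop :=
  ∀ h : ℝ, b * (2 * h * t + h ^ 2 - 2 * h * ((∑ i ∈ Finset.range N, z i) / N)) - a * h ^ 2
    ≤ shiftAvg k z N (t + h) - shiftAvg k z N t

section stationary

variable {a b : ℝ} {k K : ℝ → ℝ} {z : ℕ → ℝ}

theorem shiftAvg_mem_Icc {B : ℝ} (h0 : ∀ u, 0 ≤ k u) (hB : ∀ u, k u ≤ B) (N : ℕ) (t : ℝ) :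
    shiftAvg k z N t ∈ Set.Icc 0 B := by
  have hB0 : 0 ≤ B := (h0 0).trans (hB 0)
  refine ⟨div_nonneg (Finset.sum_nonneg fun i _ => h0 _) (Nat.cast_nonneg N), ?_⟩
  refine div_le_of_le_mul₀ (Nat.cast_nonneg N) hB0 ?_
  calc _ ≤ ∑ _i ∈ Finset.range N, B := Finset.sum_le_sum fun i _ => hB _
    _ = _ := by rw [Finset.sum_const, Finset.card_range, nsmul_eq_mul, mul_comm]

theorem abs_shiftAvg_sub_le {η s t : ℝ} (hη : 0 ≤ η) (h : ∀ u, |k (u - s) - k (u - t)| ≤ η) (N : ℕ) :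
    |shiftAvg k z N s - shiftAvg k z N t| ≤ η := by
  unfold shiftAvg
  rw [← sub_div, ← Finset.sum_sub_distrib, abs_div, Nat.abs_cast]
  refine div_le_of_le_mul₀ (Nat.cast_nonneg N) hη ?_
  calc _ ≤ ∑ i ∈ Finset.range N, |k (z i - s) - k (z i - t)| := Finset.abs_sum_le_sum_abs _ _
    _ ≤ ∑ _i ∈ Finset.range N, η := Finset.sum_le_sum fun i _ => h _
    _ = _ := by rw [Finset.sum_const, Finset.card_range, nsmul_eq_mul, mul_comm]

/-- The steps `h = ±1` suffice, as the increment of the averaged bump never exceeds `B`. -/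
theorem Stationary.abs_le_add (hb : 0 < b) {B : ℝ} (h0 : ∀ u, 0 ≤ k u)
    (hB : ∀ u, k u ≤ B) {N : ℕ} {t : ℝ} (h : Stationary a b k z N t) :
    |t| ≤ (a + B) / (2 * b) + |(∑ i ∈ Finset.range N, z i) / N| := by
  have h1 := h 1
  have h2 := h (-1)
  have m := fun s => shiftAvg_mem_Icc (z := z) h0 hB N s
  have m1 := (m (t + 1)).2
  have m2 := (m (t + -1)).2
  have m3 := (m t).1
  set Z := (∑ i ∈ Finset.range N, z i) / N
  have hZ := mul_le_mul_of_nonneg_left (le_abs_self Z) hb.le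
  have hZ' := mul_le_mul_of_nonneg_left (neg_abs_le Z) hb.le
  have e : 2 * b * ((a + B) / (2 * b) + |Z|) = a + B + 2 * b * |Z| := by field_simp
  have hb2 : 0 < 2 * b := by positivity
  rw [abs_le]
  constructor
  · refine le_of_mul_le_mul_left ?_ hb2
    rw [mul_neg, e]; nlinarith
  · refine le_of_mul_le_mul_left ?_ hb2
    rw [e]; nlinarith

theorem Stationary.neg (hk : ∀ u, k (-u) = k u) {N : ℕ} {t : ℝ} (h : Stationary a b k z N t) :
    Stationary a b k (fun i => -z i) N (-t) := by
  intro r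
  have e : ∀ s, shiftAvg k (fun i => -z i) N (-s) = shiftAvg k z N s := fun s => by
    unfold shiftAvg
    congr 1
    refine Finset.sum_congr rfl fun i _ => ?_
    rw [← hk]; congr 1; ring
  have := h (-r)
  rw [show -t + r = -(t + -r) by ring, e, e, Finset.sum_neg_distrib, neg_div]
  linarith

/-- Test with one small rational `h > 0`. Uniform continuity of `k` replaces every `t` near `t₀` by
one rational `q`, uniformly in `N`, so convergence at rational shifts is enough. -/
theorem exists_nhds_forall_not_stationary (ha : 0 < a) (hb : 0 < b) (hk : UniformContinuous k)
    (hK : ∀ s t, 0 ≤ s → s ≤ t → K t ≤ K s)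
    (hZ : Tendsto (fun N : ℕ => (∑ i ∈ Finset.range N, z i) / N) atTop (𝓝 0))
    (hlim : ∀ q : ℚ, Tendsto (fun N => shiftAvg k z N q) atTop (𝓝 (K q))) {t₀ : ℝ} (ht₀ : 0 < t₀) :
    ∃ U ∈ 𝓝 t₀, ∀ᶠ N in atTop, ∀ t ∈ U, ¬ Stationary a b k z N t := by
  obtain ⟨h, hh0, hh1⟩ := exists_rat_btwn (show (0 : ℝ) < b * t₀ / (2 * a) by positivity)
  have hah : a * h ≤ b * t₀ / 2 := by
    rw [lt_div_iff₀ (by positivity)] at hh1; linarith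
  -- The left side of `Stationary` will be at least `4η`. The right side is less than `3η`: one `η`
  -- for each of the two replacements by rational points and one for the limit.
  set η : ℝ := h * (b * t₀) / 16 with hη
  have hη0 : 0 < η := by positivity
  obtain ⟨d, hd, hkd⟩ := Metric.uniformContinuous_iff.1 hk η hη0
  have hclose : ∀ s t : ℝ, |s - t| < d → ∀ N, |shiftAvg k z N s - shiftAvg k z N t| ≤ η := by
    intro s t hst N
    refine abs_shiftAvg_sub_le hη0.le (fun u => ?_) N
    refine le_of_lt (hkd ?_)
    rw [Real.dist_eq, show u - s - (u - t) = -(s - t) by ring, abs_neg]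
    exact hst
  -- Two points within `d / 2` of `t₀` are within `d` of each other; `t₀ / 2` keeps `t ≥ t₀ / 2`.
  set d' := min (d / 2) (t₀ / 2) with hd'
  have hd'0 : 0 < d' := by positivity
  have hdd : d' ≤ d / 2 := min_le_left _ _
  have hdt : d' ≤ t₀ / 2 := min_le_right _ _
  obtain ⟨q, hq0, hq1⟩ := exists_rat_btwn (show t₀ < t₀ + d' by linarith)
  refine ⟨Metric.ball t₀ d', Metric.ball_mem_nhds _ hd'0, ?_⟩
  have l1 := (hlim (q + h)).sub (hlim q)
  have hle : K ((q + h : ℚ) : ℝ) - K q ≤ 0 := by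
    rw [sub_nonpos]
    exact hK _ _ (by linarith) (by push_cast; linarith)
  have l2 := l1.eventually_lt_const (hle.trans_lt hη0)
  have l3 := hZ.eventually_lt_const (show 0 < t₀ / 8 by positivity)
  filter_upwards [l2, l3] with N h2 h3 t ht hst
  rw [Metric.mem_ball, Real.dist_eq, abs_lt] at ht
  have hs := hst h
  have c1 := (abs_le.1 (hclose (t + h) ((q + h : ℚ) : ℝ)
    (by push_cast; rw [abs_lt]; constructor <;> linarith) N)).2
  have c2 := (abs_le.1 (hclose t q (by rw [abs_lt]; constructor <;> linarith) N)).1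
  set Z := (∑ i ∈ Finset.range N, z i) / N
  have hlow : h * (b * t₀ / 4) ≤ h * (2 * (b * t) + b * h - 2 * (b * Z) - a * h) := by
    refine mul_le_mul_of_nonneg_left ?_ hh0.le
    have : b * (t₀ / 2) ≤ b * t := by gcongr; linarith
    have : b * Z ≤ b * (t₀ / 8) := by gcongr
    have : 0 ≤ b * h := by positivity
    linarith
  have : h * (b * t₀ / 4) = 4 * η := by rw [hη]; ring
  nlinarith

/-- Once the mean of `z` is below `1` in absolute value, `Stationary.abs_le_add` confines `t` to a
bounded set; a finite cover of the remaining compact interval gives uniformity in `t`. -/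
theorem eventually_forall_stationary_lt (ha : 0 < a) (hb : 0 < b) (hk : UniformContinuous k)
    (hK : ∀ s t, 0 ≤ s → s ≤ t → K t ≤ K s)
    (hZ : Tendsto (fun N : ℕ => (∑ i ∈ Finset.range N, z i) / N) atTop (𝓝 0))
    (hlim : ∀ q : ℚ, Tendsto (fun N => shiftAvg k z N q) atTop (𝓝 (K q)))
    {B : ℝ} (h0 : ∀ u, 0 ≤ k u) (hB : ∀ u, k u ≤ B) {ε : ℝ} (hε : 0 < ε) :
    ∀ᶠ N in atTop, ∀ t, Stationary a b k z N t → t < ε := by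
  have hc : ∀ᶠ N in atTop, ∀ t ∈ Set.Icc ε ((a + B) / (2 * b) + 1), ¬ Stationary a b k z N t := by
    refine isCompact_Icc.induction_on (p := fun S => ∀ᶠ N in atTop, ∀ t ∈ S,
      ¬ Stationary a b k z N t) (by simp) (fun S T hST hT => hT.mono fun N hN t ht => hN t (hST ht))
      (fun S T hS hT => ?_) (fun t ht => ?_)
    · filter_upwards [hS, hT] with N h1 h2 t ht
      exact ht.elim (h1 t) (h2 t)
    · obtain ⟨U, hU, h⟩ := exists_nhds_forall_not_stationary ha hb hk hK hZ hlim
        (hε.trans_le ht.1)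
      exact ⟨U, mem_nhdsWithin_of_mem_nhds hU, h⟩
  have hZ1 := hZ.abs.eventually_lt_const (show |(0 : ℝ)| < 1 by simp)
  filter_upwards [hc, hZ1] with N h1 h2 t ht
  by_contra! hlt
  refine h1 t ⟨hlt, ?_⟩ ht
  linarith [le_abs_self t, ht.abs_le_add hb h0 hB]

end stationary

/-! ### Laws, limit theorems and mean square convergence -/

section sample

variable {Ω : Type*} [MeasurableSpace Ω] {P : Measure Ω} [IsProbabilityMeasure P]

/-- The law of a random variable which takes two values with complementary probabilities. -/
theorem map_eq_of_two_values {X : Ω → ℝ} (hX : Measurable X) {α β p : ℝ} (hαβ : α < β)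
    (hp₀ : 0 < p) (hp₁ : p < 1) (hβ : P {x | X x = β} = ENNReal.ofReal p)
    (hα : P {x | X x = α} = ENNReal.ofReal (1 - p)) :
    P.map X = ENNReal.ofReal p • Measure.dirac β + ENNReal.ofReal (1 - p) • Measure.dirac α := by
  have : IsProbabilityMeasure (P.map X) := Measure.isProbabilityMeasure_map hX.aemeasurable
  have hβ' : P.map X {β} = ENNReal.ofReal p := by
    rw [Measure.map_apply hX (measurableSet_singleton _)]; exact hβ
  have hα' : P.map X {α} = ENNReal.ofReal (1 - p) := by
    rw [Measure.map_apply hX (measurableSet_singleton _)]; exact hα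
  have hdisj : Disjoint ({β} : Set ℝ) {α} := by simp [hαβ.ne']
  have hfull : P.map X ({β} ∪ {α}) = 1 := by
    rw [measure_union hdisj (measurableSet_singleton _), hβ', hα',
      ← ENNReal.ofReal_add hp₀.le (by linarith)]
    simp
  have hae : ∀ᵐ x ∂P.map X, x ∈ ({β} ∪ {α} : Set ℝ) :=
    (prob_compl_eq_zero_iff (by measurability)).2 hfull
  rw [← Measure.restrict_eq_self_of_ae_mem hae, Measure.restrict_union hdisj
    (measurableSet_singleton _), Measure.restrict_singleton, Measure.restrict_singleton, hβ', hα']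

/-- Condition on `W`: the inequality holds for each fixed scale, hence for any mixture of scales. -/
theorem integral_unimodal_mul {k : ℝ → ℝ} (hk : Continuous k) {C : ℝ} (hC : ∀ u, |k u| ≤ C)
    (hanti : ∀ u v, |u| ≤ |v| → k v ≤ k u) {W η : Ω → ℝ} (hW : Measurable W) (hη : Measurable η)
    (hlaw : P.map η = gaussianReal 0 1) (hind : IndepFun W η P) (c : ℝ) {s t : ℝ}
    (hs : 0 ≤ s) (hst : s ≤ t) :
    ∫ x, k (c * (W x * η x) - t) ∂P ≤ ∫ x, k (c * (W x * η x) - s) ∂P := by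
  have : IsProbabilityMeasure (P.map W) := Measure.isProbabilityMeasure_map hW.aemeasurable
  have hprod := (indepFun_iff_map_prod_eq_prod_map_map hW.aemeasurable hη.aemeasurable).1 hind
  rw [hlaw] at hprod
  have hint : ∀ r, Integrable (fun q : ℝ × ℝ => k (c * q.1 * q.2 - r))
      ((P.map W).prod (gaussianReal 0 1)) := fun r =>
    Integrable.of_bound (by fun_prop) C (Eventually.of_forall fun q => hC _)
  have e : ∀ r, ∫ x, k (c * (W x * η x) - r) ∂P
      = ∫ w, ∫ y, k (c * w * y - r) ∂gaussianReal 0 1 ∂P.map W := fun r => by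
    rw [← integral_prod _ (hint r), ← hprod, integral_map (by fun_prop) (by fun_prop)]
    simp only [mul_assoc]
  rw [e, e]
  exact integral_mono (hint t).integral_prod_left (hint s).integral_prod_left fun w =>
    integral_scaled_gaussian_unimodal hk hC hanti (c * w) hs hst

end sample

/-- Local maxima of the profile are stationary in the quantitative sense of `Stationary`. -/
theorem stationary_of_mem_localMaxima {α β p : ℝ} (hα : 0 < α) (hαβ : α < β) (hp₀ : 0 < p)
    (hp₁ : p < 1) {N : ℕ} (hN : 1 ≤ N) {θs : ℝ} {z : ℕ → ℝ} {ξ : ℝ}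
    (hξ : ξ ∈ localMaxima α β p fun i : Fin N => θs + z i) :
    Stationary (1 / (2 * α ^ 2)) (1 / (2 * β ^ 2)) (bump α β p) z N (ξ - θs) := by
  intro h
  unfold shiftAvg
  rw [Finset.sum_range, Finset.sum_range, Finset.sum_range]
  exact stationarity hα hαβ hp₀ hp₁ hN hξ h

section sample

variable {Ω : Type*} [MeasurableSpace Ω] {P : Measure Ω} [IsProbabilityMeasure P]

theorem integral_sq_average_eq {X : ℕ → Ω → ℝ} (hX : MemLp (X 0) 2 P)
    (hind : Pairwise fun i j => IndepFun (X i) (X j) P)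
    (hident : ∀ i, IdentDistrib (X i) (X 0) P P) (hmean : ∫ x, X 0 x ∂P = 0) (N : ℕ) :
    ∫ x, ((∑ i ∈ Finset.range N, X i x) / N) ^ 2 ∂P = Var[X 0; P] / N := by
  have hL : ∀ i, MemLp (X i) 2 P := fun i => (hident i).symm.memLp_snd hX
  have hvar := IndepFun.variance_sum (s := Finset.range N) (fun i _ => hL i)
    (fun i _ j _ hij => hind hij)
  simp only [(hident _).variance_eq, Finset.sum_const, Finset.card_range, nsmul_eq_mul] at hvar
  have hm0 : P[∑ i ∈ Finset.range N, X i] = 0 := by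
    simp only [Finset.sum_apply]
    rw [integral_finsetSum _ fun i _ => (hL i).integrable one_le_two]
    exact Finset.sum_eq_zero fun i _ => (hident i).integral_eq.trans hmean
  rw [variance_of_integral_eq_zero (memLp_finsetSum' _ fun i _ => hL i).aemeasurable hm0] at hvar
  simp only [Finset.sum_apply] at hvar
  simp only [div_pow]
  rw [integral_div, hvar]
  rcases Nat.eq_zero_or_pos N with rfl | hN
  · simp
  · have : (N : ℝ) ≠ 0 := by positivity
    field_simp

/-- A sequence that tends to zero almost surely and is bounded up to terms that vanish in mean
square tends to zero in mean square. -/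
theorem tendsto_integral_sq_of_le_add {M Z : ℕ → Ω → ℝ} {C : ℝ} (hC : 0 ≤ C)
    (hM : ∀ᶠ N in atTop, AEStronglyMeasurable (M N) P) (hM0 : ∀ᶠ N in atTop, ∀ x, 0 ≤ M N x)
    (hle : ∀ᶠ N in atTop, ∀ x, M N x ≤ C + |Z N x|)
    (hlim : ∀ᵐ x ∂P, Tendsto (fun N => M N x) atTop (𝓝 0))
    (hZ : ∀ N, MemLp (Z N) 2 P)
    (hZlim : Tendsto (fun N => ∫ x, Z N x ^ 2 ∂P) atTop (𝓝 0)) :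
    Tendsto (fun N => ∫ x, M N x ^ 2 ∂P) atTop (𝓝 0) := by
  have h1 : Tendsto (fun N => ∫ x, min (M N x) C ^ 2 ∂P) atTop (𝓝 (∫ _x, (0 : ℝ) ∂P)) := by
    refine tendsto_integral_filter_of_dominated_convergence (fun _ => C ^ 2) ?_ ?_
      (integrable_const _) ?_
    · filter_upwards [hM] with N hN
      exact (hN.inf aestronglyMeasurable_const).pow 2
    · filter_upwards [hM0] with N hN
      refine Eventually.of_forall fun x => ?_
      rw [Real.norm_eq_abs, abs_of_nonneg (sq_nonneg _)]
      exact pow_le_pow_left₀ (le_min (hN x) hC) (min_le_right _ _) 2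
    · filter_upwards [hlim] with x hx
      have := (hx.min (tendsto_const_nhds (x := C))).pow 2
      simpa [min_eq_left hC] using this
  rw [integral_zero] at h1
  have h2 := (h1.const_mul 2).add (hZlim.const_mul 2)
  simp only [mul_zero, add_zero] at h2
  refine tendsto_of_tendsto_of_tendsto_of_le_of_le' tendsto_const_nhds h2
    (Eventually.of_forall fun N => integral_nonneg fun x => sq_nonneg _) ?_
  filter_upwards [hM, hM0, hle] with N m1 m2 m3
  have i1 : Integrable (fun x => min (M N x) C ^ 2) P := by
    refine Integrable.of_bound ((m1.inf aestronglyMeasurable_const).pow 2) (C ^ 2)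
      (Eventually.of_forall fun x => ?_)
    rw [Real.norm_eq_abs, abs_of_nonneg (sq_nonneg _)]
    exact pow_le_pow_left₀ (le_min (m2 x) hC) (min_le_right _ _) 2
  have i2 : Integrable (fun x => Z N x ^ 2) P := (hZ N).integrable_sq
  rw [← integral_const_mul, ← integral_const_mul,
    ← integral_add (i1.const_mul 2) (i2.const_mul 2)]
  refine integral_mono_of_nonneg (Eventually.of_forall fun x => sq_nonneg _)
    ((i1.const_mul 2).add (i2.const_mul 2)) (Eventually.of_forall fun x => ?_)
  -- The truncation at `C` is handled by dominated convergence, the excess by the `L²` bound on `Z`.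
  have h3 : M N x ≤ min (M N x) C + |Z N x| := by
    rcases min_choice (M N x) C with h | h <;> rw [h]
    · linarith [abs_nonneg (Z N x)]
    · exact m3 x
  calc M N x ^ 2 ≤ (min (M N x) C + |Z N x|) ^ 2 := pow_le_pow_left₀ (m2 x) h3 2
    _ ≤ 2 * min (M N x) C ^ 2 + 2 * Z N x ^ 2 := by
      rw [← sq_abs (Z N x)]
      nlinarith [sq_nonneg (min (M N x) C - |Z N x|)]

/-- Restricting to rational shifts yields a single null set. The factor `c` serves for both `Z` and
its reflection. -/
theorem ae_tendsto_shiftAvg {Z : ℕ → Ω → ℝ} (hmeas : ∀ i, Measurable (Z i))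
    (hind : Pairwise fun i j => IndepFun (Z i) (Z j) P)
    (hident : ∀ i, IdentDistrib (Z i) (Z 0) P P) {k : ℝ → ℝ} (hk : Continuous k) {C : ℝ}
    (hC : ∀ u, |k u| ≤ C) (c : ℝ) :
    ∀ᵐ x ∂P, ∀ q : ℚ, Tendsto (fun N => shiftAvg k (fun i => c * Z i x) N q) atTop
      (𝓝 (∫ x, k (c * Z 0 x - q) ∂P)) := by
  rw [ae_all_iff]
  intro q
  have hg : Measurable fun u : ℝ => k (c * u - q) := by fun_prop
  have := hmeas 0
  exact strong_law_ae_real (fun i x => k (c * Z i x - q))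
    (Integrable.of_bound (by fun_prop) C (Eventually.of_forall fun x => hC _))
    (fun i j hij => (hind hij).comp hg hg) fun i => (hident i).comp hg

end sample

/-! ### The main theorem -/

theorem theorem2 {Ω : Type*} [MeasurableSpace Ω] (P : Measure Ω) [IsProbabilityMeasure P]
    (α β p θs : ℝ) (hα : 0 < α) (hαβ : α < β) (hp₀ : 0 < p) (hp₁ : p < 1)
    (ωs η : ℕ → Ω → ℝ)
    (hωs : ∀ i, Measurable (ωs i)) (hη : ∀ i, Measurable (η i))
    (hβ_prob : ∀ i, P {x | ωs i x = β} = ENNReal.ofReal p)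
    (hα_prob : ∀ i, P {x | ωs i x = α} = ENNReal.ofReal (1 - p))
    (hη_law : ∀ i, P.map (η i) = gaussianReal 0 1)
    (h_indep : iIndepFun (Sum.elim ωs η) P) :
    -- the maximum exists, for every sample
    (∀ N : ℕ, 1 ≤ N → ∀ x : Ω,
      IsGreatest (deviations α β p θs (observations θs ωs η N x))
        (maxDeviation α β p θs (observations θs ωs η N x))) ∧
    -- almost sure convergence
    (∀ᵐ x ∂P, Tendsto (fun N : ℕ => maxDeviation α β p θs (observations θs ωs η N x))
      atTop (𝓝 0)) ∧
    -- convergence in mean square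
    (∀ N : ℕ, 1 ≤ N →
      MemLp (fun x => maxDeviation α β p θs (observations θs ωs η N x)) 2 P) ∧
    Tendsto (fun N : ℕ => ∫ x, maxDeviation α β p θs (observations θs ωs η N x) ^ 2 ∂P)
      atTop (𝓝 0) := by
  set Z : ℕ → Ω → ℝ := fun i x => ωs i x * η i x with hZdef
  have hβ : 0 < β := hα.trans hαβ
  have hZm : ∀ i, Measurable (Z i) := fun i => (hωs i).mul (hη i)
  have hpair : ∀ i, IndepFun (ωs i) (η i) P := fun i =>
    h_indep.indepFun (i := Sum.inl i) (j := Sum.inr i) (by simp)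
  have hmeas : ∀ s, Measurable (Sum.elim ωs η s) := fun s => by cases s <;> simp [hωs, hη]
  have hZind : Pairwise fun i j => IndepFun (Z i) (Z j) P := fun i j hij =>
    h_indep.indepFun_mul_mul hmeas (Sum.inl i) (Sum.inr i) (Sum.inl j) (Sum.inr j)
      (by simpa using hij) (by simp) (by simp) (by simpa using hij)
  have hlaw := fun i => map_eq_of_two_values (hωs i) hαβ hp₀ hp₁ (hβ_prob i) (hα_prob i)
  have hZid : ∀ i, IdentDistrib (Z i) (Z 0) P P := fun i => by
    have h : IdentDistrib (fun x => (ωs i x, η i x)) (fun x => (ωs 0 x, η 0 x)) P P := by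
      refine ⟨by fun_prop, by fun_prop, ?_⟩
      rw [(indepFun_iff_map_prod_eq_prod_map_map (hωs i).aemeasurable (hη i).aemeasurable).1
        (hpair i), (indepFun_iff_map_prod_eq_prod_map_map (hωs 0).aemeasurable
        (hη 0).aemeasurable).1 (hpair 0), hlaw, hlaw, hη_law, hη_law]
    exact h.comp measurable_mul
  have hη2 : MemLp (η 0) 2 P := by
    have : MemLp id 2 (P.map (η 0)) := by rw [hη_law]; exact memLp_id_gaussianReal 2
    exact (memLp_map_measure_iff (by fun_prop) (hη 0).aemeasurable).1 this
  have hωb : ∀ᵐ x ∂P, ‖ωs 0 x‖ ≤ β := by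
    have : ∀ᵐ w ∂P.map (ωs 0), ‖w‖ ≤ β := by
      rw [hlaw, ae_add_measure_iff]
      constructor
      · refine Measure.ae_smul_measure ?_ _
        rw [ae_dirac_iff (by measurability), Real.norm_eq_abs, abs_of_pos hβ]
      · refine Measure.ae_smul_measure ?_ _
        rw [ae_dirac_iff (by measurability), Real.norm_eq_abs, abs_of_pos hα]
        exact hαβ.le
    exact ae_of_ae_map (hωs 0).aemeasurable this
  have hZ2 : MemLp (Z 0) 2 P := by
    refine hη2.of_le_mul (c := β) (hZm 0).aestronglyMeasurable ?_
    filter_upwards [hωb] with x hx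
    rw [hZdef, norm_mul]
    gcongr
  have hmean : ∫ x, Z 0 x ∂P = 0 := by
    have h1 : ∫ x, η 0 x ∂P = 0 := by
      have := integral_map (hη 0).aemeasurable (f := id) (μ := P) (by fun_prop)
      rw [hη_law] at this
      simpa using this.symm
    have := (hpair 0).integral_mul_eq_mul_integral (hωs 0).aestronglyMeasurable
      (hη 0).aestronglyMeasurable
    rw [h1, mul_zero] at this
    exact this
  have hZi : ∀ i, MemLp (Z i) 2 P := fun i => (hZid i).symm.memLp_snd hZ2
  set k := bump α β p
  set a := 1 / (2 * α ^ 2)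
  set b := 1 / (2 * β ^ 2)
  have ha : 0 < a := by positivity
  have hb : 0 < b := by positivity
  have hk0 : ∀ u, 0 ≤ k u := bump_nonneg α β p
  have hkB : ∀ u, k u ≤ k 0 := bump_le hα hαβ p
  have hkabs : ∀ u, |k u| ≤ k 0 := fun u => by rw [abs_of_nonneg (hk0 u)]; exact hkB u
  have hkc : Continuous k := continuous_bump α β p
  set D : ℕ → Ω → ℝ := fun N x => maxDeviation α β p θs (observations θs ωs η N x) with hD
  set Zbar : ℕ → Ω → ℝ := fun N x => (∑ i ∈ Finset.range N, Z i x) / N with hZbar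
  have hgreat : ∀ N : ℕ, 1 ≤ N → ∀ x : Ω,
      IsGreatest (deviations α β p θs (observations θs ωs η N x)) (D N x) := fun N hN x =>
    isGreatest_maxDeviation hα hαβ hp₀ hp₁ hN θs _
  have hstat : ∀ N : ℕ, 1 ≤ N → ∀ x, ∃ t, D N x = |t| ∧ Stationary a b k (fun i => Z i x) N t := by
    intro N hN x
    obtain ⟨ξ, hξ, h⟩ := (hgreat N hN x).1
    exact ⟨ξ - θs, h.symm,
      stationary_of_mem_localMaxima hα hαβ hp₀ hp₁ hN (z := fun i => Z i x) hξ⟩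
  have hDmeas : ∀ N, 1 ≤ N → Measurable (D N) := fun N hN => by
    refine (measurable_maxDeviation hα hαβ hp₀ hp₁ hN θs).comp ?_
    exact measurable_pi_lambda _ fun i => (hZm i).const_add θs
  have hD0 : ∀ N, 1 ≤ N → ∀ x, 0 ≤ D N x := fun N hN x => by
    obtain ⟨t, h, -⟩ := hstat N hN x
    rw [h]; exact abs_nonneg t
  have hDle : ∀ N, 1 ≤ N → ∀ x, D N x ≤ (a + k 0) / (2 * b) + |Zbar N x| := fun N hN x => by
    obtain ⟨t, h, hs⟩ := hstat N hN x
    rw [h]; exact hs.abs_le_add hb hk0 hkB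
  have hZbar2 : ∀ N, MemLp (Zbar N) 2 P := fun N => by
    simpa only [hZbar, div_eq_inv_mul] using
      (memLp_finsetSum (Finset.range N) fun i _ => hZi i).const_mul ((N : ℝ)⁻¹)
  have hC : 0 ≤ (a + k 0) / (2 * b) := by have := hk0 0; positivity
  have hanti : ∀ c s t : ℝ, 0 ≤ s → s ≤ t →
      ∫ x, k (c * Z 0 x - t) ∂P ≤ ∫ x, k (c * Z 0 x - s) ∂P := fun c s t hs hst =>
    integral_unimodal_mul hkc hkabs (fun u v h => bump_anti hα hαβ p h) (hωs 0) (hη 0)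
      (hη_law 0) (hpair 0) c hs hst
  have has : ∀ᵐ x ∂P, Tendsto (fun N => D N x) atTop (𝓝 0) := by
    have hslln := strong_law_ae_real Z (hZ2.integrable one_le_two) hZind hZid
    rw [hmean] at hslln
    -- The factor `1` bounds `t` from above; the factor `-1`, through `Stationary.neg`, bounds `-t`.
    filter_upwards [hslln, ae_tendsto_shiftAvg hZm hZind hZid hkc hkabs 1,
      ae_tendsto_shiftAvg hZm hZind hZid hkc hkabs (-1)] with x hx h1 h2
    have huc : UniformContinuous k := uniformContinuous_bump hα hαβ p
    simp only [one_mul] at h1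
    have hx' : Tendsto (fun N : ℕ => (∑ i ∈ Finset.range N, -1 * Z i x) / N) atTop (𝓝 0) := by
      simpa [Finset.sum_neg_distrib, neg_div] using hx.neg
    rw [Metric.tendsto_nhds]
    intro ε hε
    filter_upwards [eventually_ge_atTop 1,
      eventually_forall_stationary_lt ha hb huc (fun s t => by simpa using hanti 1 s t) hx h1
        hk0 hkB hε,
      eventually_forall_stationary_lt ha hb huc (hanti (-1)) hx' h2 hk0 hkB hε] with N hN e1 e2
    obtain ⟨t, h, hs⟩ := hstat N hN x
    have hs' := hs.neg (bump_neg p)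
    simp only [← neg_one_mul (Z _ x)] at hs'
    rw [Real.dist_eq, sub_zero, h, abs_abs]
    exact abs_lt.2 ⟨by linarith [e2 _ hs'], e1 _ hs⟩
  refine ⟨hgreat, has, fun N hN => ?_, ?_⟩
  · refine ((memLp_const ((a + k 0) / (2 * b))).add (hZbar2 N).abs).mono
      (hDmeas N hN).aestronglyMeasurable (Eventually.of_forall fun x => ?_)
    have h0 := hD0 N hN x
    have h1 := hDle N hN x
    rw [Real.norm_eq_abs, Real.norm_eq_abs, abs_of_nonneg h0]
    exact h1.trans (le_abs_self _)
  · refine tendsto_integral_sq_of_le_add hC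
      ((eventually_ge_atTop 1).mono fun N hN => (hDmeas N hN).aestronglyMeasurable)
      ((eventually_ge_atTop 1).mono hD0) ((eventually_ge_atTop 1).mono hDle) has hZbar2 ?_
    simp only [hZbar, integral_sq_average_eq hZ2 hZind hZid hmean]
    exact tendsto_const_div_atTop_nhds_zero_nat _
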